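/- Let $V$ be a finite set of nodes with prescribed degrees $(k_v)_{v\in V}$ such that $\sum_v k_v$ is even and $k_v>0$ for at least one $v$; let $p_k=|\{v: k_v=k\}|/|V|$ be the degree distribution. Give each node $v$ exactly $k_v$ stubs, and give each stub an independent Uniform$[0,1]$ index. Consider the following stub-level graph traversal. It maintains a sequence $S$ of sampled nodes and a queue $Q$ of stubs, both initially empty, and a partial matching of the stubs. In each iteration: 1. If $Q$ is empty (at the start, and whenever a connected component is exhausted), let $a$ be the unmatched stub of smallest index, append its owner to $S$, enqueue all stubs of this owner, and dequeue $a$. If $Q$ is nonempty, dequeue a stub $a$ of $Q$ according to an arbitrary scheduling discipline, which may depend on $S$, $Q$ and the matching so far (first-in first-out gives breadth first search BFS, last-in first-out gives depth first search). 2. Match $a$ with the unmatched stub $b\ne a$ of smallest index. If the owner of $b$ is not in $S$, append it to $S$ and enqueue all its stubs except $b$; otherwise remove $b$ from $Q$. The traversal ends when all stubs are matched. A node is sampled by time $t$ if it was appended to $S$ at a stub of index at most $t$ (the stub $a$ of an iteration that starts with $Q$ empty, or the stub $b$). Expectations are over the stub indices. For every scheduling discipline (in particular for BFS): (i) The resulting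 matching is a uniformly random perfect matching of the stubs; that is, the constructed graph is the configuration model $RG(p_k)$. (ii) For $t\in[0,1]$ and $k\ge 0$, the expected fraction of nodes that have degree $k$ and are sampled by time $t$ is $f_k(t)=p_k\,(1-(1-t)^k)$. (iii) For $t\in[0,1]$, the expected fraction of nodes sampled by time $t$ is $f(t)=1-\sum_k p_k(1-t)^k$. The function $f$ is continuous and strictly increasing on $[0,1]$ and maps $[0,1]$ bijectively onto $[0,1-p_0]$ (which is $[0,1]$ if there are no nodes of degree $0$); let $t(\cdot):[0,1-p_0]\to[0,1]$ be its inverse. (iv) Let $0<f\le 1-p_0$. Define the expected observed degree distribution after covering a fraction $f$ of the nodes, $q_k(f)$, as the expected number of sampled nodes of degree $k$ divided by the expected number of sampled nodes, both at time $t(f)$. Then $t(f)\in(0,1]$ and $$q_k(f)=\frac{p_k\,\bigl(1-(1-t(f))^k\bigr)}{\sum_l p_l\,\bigl(1-(1-t(f))^l\bigr)}\qquad (k\ge 0),$$ where the denominator is positive, and $\sum_k q_k(f)=1$. The expected observed average degree, i.e. the expected total degree of the sampled nodes divided by the expected number of sampled nodes, both at time $t(f)$, equals $\sum_k k\,q_k(f)$.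 -/

import Mathlib

open MeasureTheory Set

namespace StubTraversal

variable {V : Type*} {d : V → ℕ}

/-- The stubs (half-edges) of a degree sequence `d`: the node `v` owns `d v` of them; the owner of
the stub `a` is `a.1`. -/
abbrev Stub (d : V → ℕ) : Type _ := Σ v : V, Fin (d v)

/-- A state of the stub-level traversal. -/
structure State (d : V → ℕ) where
  /-- The stubs at which nodes were discovered, in order of discovery. The owners of these stubs
  form the sequence `S` of sampled nodes. -/
  entry : List (Stub d)
  /-- The discovered, but not yet followed, stubs `Q`. -/
  queue : List (Stub d)
  /-- The pairs of stubs matched so far, in order. -/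
  edges : List (Stub d × Stub d)

/-- The sequence `S` of sampled nodes. -/
def State.sampled (s : State d) : List V := s.entry.map Sigma.fst

/-- A scheduling discipline: which stub is dequeued next from a nonempty queue. It may depend on
everything that has happened so far. -/
structure Discipline (d : V → ℕ) where
  pick : (s : State d) → s.queue ≠ [] → Stub d
  pick_mem : ∀ s h, pick s h ∈ s.queue

/-- Breadth first search: first-in first-out. -/
def bfs (d : V → ℕ) : Discipline d where
  pick s h := s.queue.head h
  pick_mem _ h := List.head_mem h

/-- Depth first search: last-in first-out. -/
def dfs (d : V → ℕ) : Discipline d where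
  pick s h := s.queue.getLast h
  pick_mem _ h := List.getLast_mem h

/-- The state before the traversal starts. -/
def State.init (d : V → ℕ) : State d := ⟨[], [], []⟩

section Traversal

variable [DecidableEq V]

/-- All stubs of the owner of `b`, except `b`. -/
def otherStubs (b : Stub d) : List (Stub d) :=
  ((List.finRange (d b.1)).map (fun i => (⟨b.1, i⟩ : Stub d))).erase b

variable [Fintype V]

/-- The stubs that are still unmatched. -/
def State.unmatched (s : State d) : Finset (Stub d) :=
  Finset.univ.filter (fun a => ∀ e ∈ s.edges, a ≠ e.1 ∧ a ≠ e.2)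

/-- The stub of smallest index in `U`, if there is any: the next stub of `U` met when the interval
`[0,1]` is scanned from left to right. -/
noncomputable def scan (u : Stub d → unitInterval) (U : Finset (Stub d)) : Option (Stub d) :=
  open Classical in
  if h : U.Nonempty then some (Classical.choose (U.exists_min_image u h)) else none

/-- Follow the stub `a`, which has just been dequeued: its partner `b` is the unmatched stub
(other than `a`) of smallest index. If the owner of `b` is already sampled, then `b` is removed from
the queue; otherwise this owner is sampled and all its other stubs are enqueued. -/
noncomputable def follow (u : Stub d → unitInterval) (a : Stub d) (s : State d) : State d :=
  match scan u (s.unmatched.erase a) with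
  | none => s
  | some b =>
    if b.1 ∈ s.sampled then
      { entry := s.entry
        queue := s.queue.erase b
        edges := s.edges ++ [(a, b)] }
    else
      { entry := s.entry ++ [b]
        queue := s.queue ++ otherStubs b
        edges := s.edges ++ [(a, b)] }

/-- One iteration of the traversal. If the queue is nonempty, a stub is dequeued according to the
discipline and followed. If it is empty (at the start, and whenever a connected component has been
exhausted), the scan of `[0,1]` continues to the next unmatched stub `a`; the owner of `a` is
sampled, its stubs are enqueued, and `a` is the first of them to be dequeued and followed. -/
noncomputable def step (D : Discipline d) (u : Stub d → unitInterval) (s : State d) : State d :=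
  open Classical in
  if h : s.queue = [] then
    match scan u s.unmatched with
    | none => s
    | some a =>
      follow u a { entry := s.entry ++ [a], queue := otherStubs a, edges := s.edges }
  else
    follow u (D.pick s h) { s with queue := s.queue.erase (D.pick s h) }

/-- The final state: each iteration matches two stubs, so all stubs are matched after as many
iterations as half their number. -/
noncomputable def run (D : Discipline d) (u : Stub d → unitInterval) : State d :=
  (step D u)^[Fintype.card (Stub d) / 2] (State.init d)

/-- The set of edges (unordered pairs of stubs) that the traversal constructs. -/
noncomputable def matching (D : Discipline d) (u : Stub d → unitInterval) :
    Finset (Sym2 (Stub d)) :=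
  ((run D u).edges.map (fun e => s(e.1, e.2))).toFinset

/-- A perfect matching of a set of stubs: every stub lies in exactly one pair, and no stub is
paired with itself. -/
def IsPerfectMatching {α : Type*} (M : Finset (Sym2 α)) : Prop :=
  (∀ e ∈ M, ¬ e.IsDiag) ∧ ∀ a : α, ∃! e, e ∈ M ∧ a ∈ e

/-- The nodes sampled by time `t`. When a node is discovered at the stub `b`, the scan of `[0,1]`
is at the index of `b`, which is therefore the time of the discovery. -/
noncomputable def sampledBy (D : Discipline d) (u : Stub d → unitInterval) (t : ℝ) : Finset V :=
  open Classical in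
  Finset.univ.filter (fun v => ∃ b ∈ (run D u).entry, b.1 = v ∧ (u b : ℝ) ≤ t)

end Traversal

section Expectations

variable [Fintype V]

/-- The degree distribution `p k`: the fraction of nodes that have degree `k`. -/
noncomputable def degreeDist (d : V → ℕ) (k : ℕ) : ℝ :=
  ((Finset.univ.filter (fun v => d v = k)).card : ℝ) / Fintype.card V

/-- The largest degree. -/
def maxDegree (d : V → ℕ) : ℕ := Finset.univ.sup d

variable [DecidableEq V]

/-! The indices of the stubs are independent and uniform on `[0,1]`: the expectations below are over
the product measure `volume` on `Stub d → unitInterval`. -/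

/-- The expected fraction `f_k(t)` of nodes that have degree `k` and are sampled by time `t`. -/
noncomputable def expectedSampled (D : Discipline d) (k : ℕ) (t : ℝ) : ℝ :=
  ∫ u : Stub d → unitInterval,
    (((sampledBy D u t).filter (fun v => d v = k)).card : ℝ) / Fintype.card V

/-- The expected fraction `f(t)` of nodes, of any degree, that are sampled by time `t`. -/
noncomputable def expectedCovered (D : Discipline d) (t : ℝ) : ℝ :=
  ∫ u : Stub d → unitInterval, ((sampledBy D u t).card : ℝ) / Fintype.card V

/-- The expected average over all nodes of degree times indicator of being sampled by time `t`. -/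
noncomputable def expectedSampledDegree (D : Discipline d) (t : ℝ) : ℝ :=
  ∫ u : Stub d → unitInterval, (∑ v ∈ sampledBy D u t, (d v : ℝ)) / Fintype.card V

/-- The time `t(f)` in `[0,1]` at which the expected covered fraction is `f`. -/
noncomputable def coverTime (D : Discipline d) (f : ℝ) : ℝ :=
  Function.invFunOn (expectedCovered D) (Icc 0 1) f

/-- The expected observed degree distribution `q_k(f)` after covering a fraction `f` of the nodes:
the normalized expected fractions of sampled nodes of each degree at the time `t(f)`. -/
noncomputable def observedDist (D : Discipline d) (k : ℕ) (f : ℝ) : ℝ :=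
  expectedSampled D k (coverTime D f) / expectedCovered D (coverTime D f)

/-- The expected observed average degree after covering a fraction `f` of the nodes: the expected
total degree of the sampled nodes over their expected number, at the time `t(f)`. -/
noncomputable def observedMean (D : Discipline d) (f : ℝ) : ℝ :=
  expectedSampledDegree D (coverTime D f) / expectedCovered D (coverTime D f)

end Expectations

end StubTraversal

/-! Two independent facts carry the theorem.

Sampling times are deterministic in the indices. When a node is discovered, none of its stubs has
been matched, so all of them compete in the scan that finds its entry stub; that stub therefore has
the smallest index of the node. In the end every stub is matched, so every node of positive degree
is sampled. Hence `v` is sampled by time `t` iff some stub of `v` has index at most `t`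
(`mem_sampledBy_iff`). The discipline and the graph have dropped out: this event has probability `1
- (1 - t) ^ d v`, and linearity of expectation gives all the formulas. Strict monotonicity and the
intermediate value theorem then yield the inverse `coverTime`.

Uniformity is the principle of deferred decisions. The past of the traversal only says which stub
came first in certain sets, and this is invariant under exchanging the indices of the stubs that
remain unmatched. So each of the `2k+1` candidate partners is equally likely to come next, whichever
stub the discipline dequeues. By induction (`uniformFrom`) every perfect matching has probability `∏
1/(2j+1)`. Ties between indices have probability zero and are excluded by `distinctIndices`. -/

set_option linter.unusedSectionVars false

namespace StubTraversal

/-! ### Invariants of the traversal, for fixed indices -/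

section Combinatorics

variable {V : Type*} [Fintype V] [DecidableEq V] {d : V → ℕ}

/-- The set of unordered edges built so far. -/
def State.edgeSet (s : State d) : Finset (Sym2 (Stub d)) :=
  (s.edges.map (fun e => s(e.1, e.2))).toFinset

theorem State.mem_unmatched_iff {s : State d} {x : Stub d} :
    x ∈ s.unmatched ↔ ∀ e ∈ s.edgeSet, x ∉ e := by
  simp only [State.unmatched, State.edgeSet, Finset.mem_filter, Finset.mem_univ, true_and,
    List.mem_toFinset, List.mem_map, forall_exists_index, and_imp, forall_apply_eq_imp_iff₂,
    Sym2.mem_iff, not_or, ne_eq]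

theorem State.unmatched_congr {s s' : State d} (h : s.edges = s'.edges) :
    s.unmatched = s'.unmatched := by
  simp [State.unmatched, h]

theorem scan_spec {u : Stub d → unitInterval} {U : Finset (Stub d)} (h : U.Nonempty) :
    ∃ b ∈ U, scan u U = some b ∧ ∀ x ∈ U, u b ≤ u x := by
  have hc := Classical.choose_spec (U.exists_min_image u h)
  exact ⟨_, hc.1, by simp [scan, h], hc.2⟩

theorem scan_eq_some {u : Stub d → unitInterval} {U : Finset (Stub d)} {b : Stub d} (hb : b ∈ U)
    (hlt : ∀ x ∈ U, x ≠ b → u b < u x) : scan u U = some b := by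
  obtain ⟨c, hcU, hc, hmin⟩ := scan_spec (u := u) ⟨b, hb⟩
  by_cases h : c = b
  · rw [hc, h]
  · exact absurd (hmin b hb) (not_le.2 (hlt c hcU h))

theorem mem_otherStubs {a x : Stub d} : x ∈ otherStubs a ↔ x ≠ a ∧ x.1 = a.1 := by
  have hn : ((List.finRange (d a.1)).map (fun i => (⟨a.1, i⟩ : Stub d))).Nodup :=
    (List.nodup_finRange _).map (fun i j h => by simpa using h)
  rw [otherStubs, hn.mem_erase_iff]
  refine and_congr_right fun _ => ⟨?_, ?_⟩
  · rintro h
    obtain ⟨i, -, rfl⟩ := List.mem_map.1 h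
    rfl
  · intro h
    obtain ⟨v, i⟩ := x
    simp only at h
    subst h
    exact List.mem_map.2 ⟨i, List.mem_finRange i, rfl⟩

theorem nodup_otherStubs (a : Stub d) : (otherStubs a).Nodup :=
  ((List.nodup_finRange _).map (fun i j h => by simpa using h)).erase _

/-- The state after the dequeued stub `a` has been matched with `b`. -/
def link (a b : Stub d) (s : State d) : State d :=
  if b.1 ∈ s.sampled then
    { entry := s.entry
      queue := s.queue.erase b
      edges := s.edges ++ [(a, b)] }
  else
    { entry := s.entry ++ [b]
      queue := s.queue ++ otherStubs b
      edges := s.edges ++ [(a, b)] }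

/-- The state after the owner of `a` has been sampled and `a` has been dequeued. -/
def discover (a : Stub d) (s : State d) : State d :=
  { entry := s.entry ++ [a], queue := otherStubs a, edges := s.edges }

/-- The state after `a` has been dequeued. -/
def dequeue (a : Stub d) (s : State d) : State d :=
  { s with queue := s.queue.erase a }

theorem follow_of_scan {u : Stub d → unitInterval} {a b : Stub d} {s : State d}
    (h : scan u (s.unmatched.erase a) = some b) : follow u a s = link a b s := by
  simp only [follow, h, link]

theorem step_of_queue_nil {D : Discipline d} {u : Stub d → unitInterval} {s : State d}
    {a : Stub d} (hq : s.queue = []) (h : scan u s.unmatched = some a) :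
    step D u s = follow u a (discover a s) := by
  simp only [step, hq, dite_true, h, discover]

theorem step_of_queue_ne_nil {D : Discipline d} {u : Stub d → unitInterval} {s : State d}
    (hq : s.queue ≠ []) : step D u s = follow u (D.pick s hq) (dequeue (D.pick s hq) s) := by
  simp only [step, hq, dite_false, dequeue]

theorem edges_link (a b : Stub d) (s : State d) : (link a b s).edges = s.edges ++ [(a, b)] := by
  unfold link; split <;> rfl

theorem edgeSet_link (a b : Stub d) (s : State d) :
    (link a b s).edgeSet = insert s(a, b) s.edgeSet := by
  ext e
  simp [State.edgeSet, edges_link, eq_comm]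

theorem unmatched_link (a b : Stub d) (s : State d) :
    (link a b s).unmatched = (s.unmatched.erase a).erase b := by
  ext x
  simp only [State.mem_unmatched_iff, edgeSet_link, Finset.mem_erase, Finset.forall_mem_insert,
    Sym2.mem_iff, not_or]
  tauto

theorem mem_sampled_link {a b : Stub d} {s : State d} {v : V} :
    v ∈ (link a b s).sampled ↔ v ∈ s.sampled ∨ v = b.1 := by
  unfold link
  split_ifs with h
  · exact ⟨Or.inl, fun h' => h'.elim id (fun e => e ▸ h)⟩
  · simp [State.sampled]

/-- The edges built so far form a partial matching. -/
def State.EdgesMatch (s : State d) : Prop :=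
  (∀ e ∈ s.edgeSet, ¬ e.IsDiag) ∧
    ∀ x, ∀ e ∈ s.edgeSet, ∀ e' ∈ s.edgeSet, x ∈ e → x ∈ e' → e = e'

/-- The invariant of the traversal when the stub `a` has been dequeued, but not yet matched. -/
structure Pending (a : Stub d) (s : State d) : Prop where
  edgesMatch : s.EdgesMatch
  owner : ∀ x, x ∉ s.unmatched → x.1 ∈ s.sampled
  nodup : s.queue.Nodup
  mem_unmatched : a ∈ s.unmatched
  mem_sampled : a.1 ∈ s.sampled
  mem_queue : ∀ x, x ∈ s.queue ↔ x ≠ a ∧ x ∈ s.unmatched ∧ x.1 ∈ s.sampled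

/-- The invariant of the traversal between two iterations. -/
structure Consistent (s : State d) : Prop where
  edgesMatch : s.EdgesMatch
  owner : ∀ x, x ∉ s.unmatched → x.1 ∈ s.sampled
  nodup : s.queue.Nodup
  mem_queue : ∀ x, x ∈ s.queue ↔ x ∈ s.unmatched ∧ x.1 ∈ s.sampled

theorem consistent_init : Consistent (State.init d) where
  edgesMatch := by simp [State.EdgesMatch, State.edgeSet, State.init]
  owner := by simp [State.unmatched, State.init]
  nodup := by simp [State.init]
  mem_queue := by simp [State.init, State.sampled]

theorem Consistent.pending_dequeue {s : State d} (hs : Consistent s) {a : Stub d}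
    (ha : a ∈ s.queue) : Pending a (dequeue a s) where
  edgesMatch := hs.edgesMatch
  owner := hs.owner
  nodup := hs.nodup.erase a
  mem_unmatched := ((hs.mem_queue a).1 ha).1
  mem_sampled := ((hs.mem_queue a).1 ha).2
  mem_queue x := by
    change x ∈ s.queue.erase a ↔ x ≠ a ∧ x ∈ s.unmatched ∧ x.1 ∈ s.sampled
    rw [hs.nodup.mem_erase_iff, hs.mem_queue]

theorem mem_sampled_discover {a : Stub d} {s : State d} {v : V} :
    v ∈ (discover a s).sampled ↔ v ∈ s.sampled ∨ v = a.1 := by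
  simp [discover, State.sampled]

/-- The queue holds all unmatched stubs of sampled nodes, so an empty queue leaves only stubs of
undiscovered nodes. -/
theorem Consistent.notMem_sampled {s : State d} (hs : Consistent s) {a : Stub d}
    (hq : s.queue = []) (ha : a ∈ s.unmatched) : a.1 ∉ s.sampled := fun h => by
  have := (hs.mem_queue a).2 ⟨ha, h⟩
  simp [hq] at this

theorem Consistent.pending_discover {s : State d} (hs : Consistent s) {a : Stub d}
    (hq : s.queue = []) (ha : a ∈ s.unmatched) : Pending a (discover a s) where
  edgesMatch := hs.edgesMatch
  owner x hx := mem_sampled_discover.2 (Or.inl (hs.owner x hx))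
  nodup := nodup_otherStubs a
  mem_unmatched := ha
  mem_sampled := mem_sampled_discover.2 (Or.inr rfl)
  mem_queue x := by
    rw [mem_sampled_discover]
    change x ∈ otherStubs a ↔ x ≠ a ∧ x ∈ s.unmatched ∧ (x.1 ∈ s.sampled ∨ x.1 = a.1)
    rw [mem_otherStubs]
    refine and_congr_right fun _ => ⟨fun h => ⟨?_, Or.inr h⟩, ?_⟩
    · by_contra hx
      exact hs.notMem_sampled hq ha (h ▸ hs.owner x hx)
    · rintro ⟨hx, h | h⟩
      · exact absurd h (hs.notMem_sampled hq hx)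
      · exact h

theorem Pending.consistent_link {a b : Stub d} {s : State d} (hs : Pending a s)
    (hb : b ∈ s.unmatched.erase a) : Consistent (link a b s) := by
  obtain ⟨hba, hbu⟩ := Finset.mem_erase.1 hb
  have hau := hs.mem_unmatched
  rw [State.mem_unmatched_iff] at hbu hau
  refine ⟨⟨?_, ?_⟩, ?_, ?_, ?_⟩
  · intro e he
    rw [edgeSet_link, Finset.mem_insert] at he
    rcases he with rfl | he
    · simpa using hba.symm
    · exact hs.edgesMatch.1 e he
  · intro x e he e' he' hx hx'
    rw [edgeSet_link, Finset.mem_insert] at he he'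
    have key : ∀ e ∈ s.edgeSet, x ∈ e → x ∉ s(a, b) := by
      intro f hf hx h
      rcases Sym2.mem_iff.1 h with rfl | rfl
      · exact hau f hf hx
      · exact hbu f hf hx
    rcases he with rfl | he <;> rcases he' with rfl | he'
    · rfl
    · exact absurd hx (key _ he' hx')
    · exact absurd hx' (key _ he hx)
    · exact hs.edgesMatch.2 x e he e' he' hx hx'
  · intro x hx
    rw [mem_sampled_link]
    rw [unmatched_link, Finset.mem_erase, Finset.mem_erase] at hx
    by_cases h1 : x = b
    · exact Or.inr (h1 ▸ rfl)
    by_cases h2 : x = a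
    · exact Or.inl (h2 ▸ hs.mem_sampled)
    · exact Or.inl (hs.owner x (fun h => hx ⟨h1, h2, h⟩))
  · unfold link
    split_ifs with h
    · exact hs.nodup.erase b
    · refine hs.nodup.append (nodup_otherStubs b) fun x hx hx' => h ?_
      rw [← (mem_otherStubs.1 hx').2]
      exact ((hs.mem_queue x).1 hx).2.2
  · intro x
    rw [mem_sampled_link, unmatched_link, Finset.mem_erase, Finset.mem_erase]
    unfold link
    split_ifs with h
    · simp only [hs.nodup.mem_erase_iff, hs.mem_queue]
      have : x.1 = b.1 → x.1 ∈ s.sampled := fun e => e ▸ h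
      tauto
    · simp only [List.mem_append, hs.mem_queue, mem_otherStubs]
      have h1 : x.1 = b.1 → x ∈ s.unmatched := fun e => by
        by_contra hx
        exact h (e ▸ hs.owner x hx)
      have h2 : x.1 = b.1 → x ≠ a := by
        rintro e rfl
        exact h (e ▸ hs.mem_sampled)
      have h3 : x = b → x.1 ∉ s.sampled := by
        rintro rfl; exact h
      tauto

/-- Every node is entered at a stub of smallest index. -/
def EntryMin (u : Stub d → unitInterval) (s : State d) : Prop :=
  ∀ b ∈ s.entry, ∀ i, u b ≤ u ⟨b.1, i⟩

/-- Merges the two kinds of iteration: whether the queue is empty or not, what remains is to follow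
a pending stub. -/
theorem step_of_nonempty {D : Discipline d} {u : Stub d → unitInterval} {s : State d}
    (hs : Consistent s) (hm : EntryMin u s) (hne : s.unmatched.Nonempty) :
    ∃ a s', step D u s = follow u a s' ∧ Pending a s' ∧ EntryMin u s' ∧ s'.edges = s.edges := by
  by_cases hq : s.queue = []
  · obtain ⟨a, ha, hsc, hmin⟩ := scan_spec (u := u) hne
    refine ⟨a, _, step_of_queue_nil hq hsc, hs.pending_discover hq ha, ?_, rfl⟩
    intro b hb i
    rcases List.mem_append.1 hb with hb | hb
    · exact hm b hb i
    · obtain rfl := List.mem_singleton.1 hb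
      apply hmin
      by_contra hx
      exact hs.notMem_sampled hq ha (hs.owner ⟨b.1, i⟩ hx)
  · exact ⟨_, _, step_of_queue_ne_nil hq, hs.pending_dequeue (D.pick_mem s hq), hm, rfl⟩

/-- If the owner of `b` is new, it does not own `a` and none of its stubs is matched, so the minimum
defining `b` runs over all of them. -/
theorem Pending.entryMin_link {u : Stub d → unitInterval} {a b : Stub d} {s : State d}
    (hs : Pending a s) (hm : EntryMin u s) (hmin : ∀ x ∈ s.unmatched.erase a, u b ≤ u x) :
    EntryMin u (link a b s) := by
  unfold link
  split_ifs with h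
  · exact hm
  · intro c hc i
    rcases List.mem_append.1 hc with hc | hc
    · exact hm c hc i
    · obtain rfl := List.mem_singleton.1 hc
      refine hmin _ (Finset.mem_erase.2 ⟨?_, ?_⟩)
      · intro e
        exact h (by have := hs.mem_sampled; rwa [← e] at this)
      · by_contra hx
        exact h (hs.owner ⟨c.1, i⟩ hx)

theorem step_spec (D : Discipline d) (u : Stub d → unitInterval) {s : State d}
    (hs : Consistent s) (hm : EntryMin u s) (hc : 2 ≤ s.unmatched.card) :
    Consistent (step D u s) ∧ EntryMin u (step D u s) ∧
      (step D u s).unmatched.card + 2 = s.unmatched.card := by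
  obtain ⟨a, s', hstep, hp, hm', he⟩ :=
    step_of_nonempty (D := D) hs hm (Finset.card_pos.1 (by omega))
  have hU := State.unmatched_congr he
  have hcard := Finset.card_erase_of_mem hp.mem_unmatched
  rw [hU] at hcard
  have hne : (s'.unmatched.erase a).Nonempty := Finset.card_pos.1 (by rw [hU]; omega)
  obtain ⟨b, hb, hsc, hmin⟩ := scan_spec (u := u) hne
  rw [hstep, follow_of_scan hsc]
  refine ⟨hp.consistent_link hb, hp.entryMin_link hm' hmin, ?_⟩
  rw [unmatched_link, Finset.card_erase_of_mem hb, hU]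
  omega

theorem iterate_step_spec (D : Discipline d) (u : Stub d → unitInterval) (k : ℕ) :
    ∀ {s : State d}, Consistent s → EntryMin u s → s.unmatched.card = 2 * k →
      Consistent ((step D u)^[k] s) ∧ EntryMin u ((step D u)^[k] s) ∧
      ((step D u)^[k] s).unmatched = ∅ := by
  induction k with
  | zero =>
    intro s hs hm hc
    exact ⟨hs, hm, Finset.card_eq_zero.1 (by simpa using hc)⟩
  | succ k ih =>
    intro s hs hm hc
    obtain ⟨h1, h2, h3⟩ := step_spec D u hs hm (by omega)
    exact ih h1 h2 (by omega)

theorem edgeSet_subset_follow (u : Stub d → unitInterval) (a : Stub d) (s : State d) :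
    s.edgeSet ⊆ (follow u a s).edgeSet := by
  cases h : scan u (s.unmatched.erase a) with
  | none => simp [follow, h]
  | some b =>
    rw [follow_of_scan h, edgeSet_link]
    exact Finset.subset_insert _ _

theorem edgeSet_subset_step (D : Discipline d) (u : Stub d → unitInterval) (s : State d) :
    s.edgeSet ⊆ (step D u s).edgeSet := by
  by_cases hq : s.queue = []
  · cases h : scan u s.unmatched with
    | none => simp [step, hq, h]
    | some a =>
      rw [step_of_queue_nil hq h]
      exact edgeSet_subset_follow u a (discover a s)
  · rw [step_of_queue_ne_nil hq]
    exact edgeSet_subset_follow u _ (dequeue _ s)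

theorem edgeSet_subset_iterate (D : Discipline d) (u : Stub d → unitInterval) (k : ℕ)
    (s : State d) : s.edgeSet ⊆ ((step D u)^[k] s).edgeSet := by
  induction k generalizing s with
  | zero => exact subset_rfl
  | succ k ih => exact (edgeSet_subset_step D u s).trans (ih _)

theorem unmatched_init : (State.init d).unmatched = Finset.univ := by
  simp [State.unmatched, State.init]

theorem card_unmatched_init (heven : Even (∑ v, d v)) :
    (State.init d).unmatched.card = 2 * (Fintype.card (Stub d) / 2) := by
  have h : Fintype.card (Stub d) = ∑ v, d v := by simp [Stub]
  rw [unmatched_init, Finset.card_univ, h]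
  exact (Nat.two_mul_div_two_of_even heven).symm

theorem run_spec (heven : Even (∑ v, d v)) (D : Discipline d) (u : Stub d → unitInterval) :
    Consistent (run D u) ∧ EntryMin u (run D u) ∧ (run D u).unmatched = ∅ :=
  iterate_step_spec D u _ consistent_init (by simp [EntryMin, State.init])
    (card_unmatched_init heven)

theorem isPerfectMatching_matching (heven : Even (∑ v, d v)) (D : Discipline d)
    (u : Stub d → unitInterval) : IsPerfectMatching (matching D u) := by
  obtain ⟨h1, -, h3⟩ := run_spec heven D u
  change IsPerfectMatching (run D u).edgeSet
  refine ⟨h1.edgesMatch.1, fun x => ?_⟩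
  have hx : x ∉ (run D u).unmatched := by simp [h3]
  rw [State.mem_unmatched_iff] at hx
  push Not at hx
  obtain ⟨e, he, hxe⟩ := hx
  exact ⟨e, ⟨he, hxe⟩, fun e' ⟨he', hxe'⟩ => h1.edgesMatch.2 x e' he' e he hxe' hxe⟩

/-- All stubs end up matched, so every node with a stub has an entry stub, and by `EntryMin` it is
the earliest one. This holds for all `u`, ties included. -/
theorem mem_sampledBy_iff (heven : Even (∑ v, d v)) (D : Discipline d)
    (u : Stub d → unitInterval) (t : ℝ) (v : V) :
    v ∈ sampledBy D u t ↔ ∃ i, (u ⟨v, i⟩ : ℝ) ≤ t := by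
  obtain ⟨h1, h2, h3⟩ := run_spec heven D u
  simp only [sampledBy, Finset.mem_filter, Finset.mem_univ, true_and]
  constructor
  · rintro ⟨b, -, rfl, hb⟩
    exact ⟨b.2, hb⟩
  · rintro ⟨i, hi⟩
    have hv : v ∈ (run D u).sampled := h1.owner ⟨v, i⟩ (by simp [h3])
    obtain ⟨b, hb, rfl⟩ := List.mem_map.1 hv
    exact ⟨b, hb, rfl, le_trans (h2 b hb i) hi⟩

end Combinatorics

/-! ### Exchangeability of independent uniform indices -/

section Exchangeable

open scoped ENNReal

variable {α : Type*} [Fintype α]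

/-- The event that all indices are distinct. -/
def distinctIndices (α : Type*) : Set (α → unitInterval) := {u | Function.Injective u}

/-- The event that `b` has the smallest index in `U`. -/
def firstOf (U : Finset α) (b : α) : Set (α → unitInterval) :=
  {u | ∀ x ∈ U, x ≠ b → u b < u x}

theorem measurableSet_firstOf (U : Finset α) (b : α) : MeasurableSet (firstOf U b) := by
  simp only [firstOf, ofPred_forall]
  exact MeasurableSet.iInter fun x => MeasurableSet.iInter fun _ => MeasurableSet.iInter fun _ =>
    measurableSet_lt (measurable_pi_apply b) (measurable_pi_apply x)

/-- By independence the pair of indices has the product law, for which the diagonal is null because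
its sections are single points. -/
theorem volume_setOf_eq_apply {x y : α} (h : x ≠ y) :
    volume {u : α → unitInterval | u x = u y} = 0 := by
  have hind : ProbabilityTheory.IndepFun (fun u : α → unitInterval => u x) (fun u => u y) :=
    (ProbabilityTheory.iIndepFun_pi (μ := fun _ : α => (volume : Measure unitInterval))
      (X := fun _ => id) (fun _ => aemeasurable_id)).indepFun h
  rw [ProbabilityTheory.indepFun_iff_map_prod_eq_prod_map_map
    (measurable_pi_apply x).aemeasurable (measurable_pi_apply y).aemeasurable] at hind
  have hmap : ∀ z : α, Measure.map (fun u : α → unitInterval => u z) volume = volume := fun z =>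
    (measurePreserving_eval (fun _ : α => (volume : Measure unitInterval)) z).map_eq
  rw [hmap, hmap] at hind
  have hm : MeasurableSet {p : unitInterval × unitInterval | p.1 = p.2} :=
    measurableSet_eq_fun measurable_fst measurable_snd
  have h0 : (volume.prod volume) {p : unitInterval × unitInterval | p.1 = p.2} = 0 := by
    rw [Measure.measure_prod_null hm]
    refine Filter.Eventually.of_forall fun a => ?_
    have : Prod.mk a ⁻¹' {p : unitInterval × unitInterval | p.1 = p.2} = {a} := by
      ext b; simp [eq_comm]
    change volume (Prod.mk a ⁻¹' _) = 0
    rw [this]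
    simp
  rw [← hind, Measure.map_apply (by fun_prop) hm] at h0
  exact h0

theorem measurableSet_distinctIndices : MeasurableSet (distinctIndices α) := by
  simp only [distinctIndices, Function.Injective, ofPred_forall]
  refine MeasurableSet.iInter fun x => MeasurableSet.iInter fun y => ?_
  exact MeasurableSet.imp
    (measurableSet_eq_fun (measurable_pi_apply x) (measurable_pi_apply y)) (MeasurableSet.const _)

theorem volume_compl_distinctIndices : volume (distinctIndices α)ᶜ = 0 := by
  have : (distinctIndices α)ᶜ ⊆ ⋃ x : α, ⋃ y : α, ⋃ _ : x ≠ y, {u | u x = u y} := by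
    intro u hu
    simp only [distinctIndices, mem_compl_iff, mem_ofPred_eq, Function.Injective, not_forall] at hu
    obtain ⟨x, y, h, hne⟩ := hu
    exact mem_iUnion.2 ⟨x, mem_iUnion.2 ⟨y, mem_iUnion.2 ⟨hne, h⟩⟩⟩
  refine measure_mono_null this ?_
  simp only [measure_iUnion_null_iff]
  exact fun x y h => volume_setOf_eq_apply h

theorem volume_distinctIndices : volume (distinctIndices α) = 1 := by
  rw [prob_compl_eq_zero_iff measurableSet_distinctIndices |>.1 volume_compl_distinctIndices]

theorem disjoint_firstOf {U : Finset α} {b c : α} (hb : b ∈ U) (hc : c ∈ U) (hne : b ≠ c) :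
    Disjoint (firstOf U b) (firstOf U c) :=
  Set.disjoint_left.2 fun _ h h' => lt_asymm (h c hc hne.symm) (h' b hb hne)

theorem exists_mem_firstOf {U : Finset α} (hU : U.Nonempty) {u : α → unitInterval}
    (hu : u ∈ distinctIndices α) : ∃ b ∈ U, u ∈ firstOf U b := by
  obtain ⟨b, hb, hmin⟩ := U.exists_min_image u hU
  exact ⟨b, hb, fun x hx hne => lt_of_le_of_ne (hmin x hx) fun e => hne (hu e.symm)⟩

theorem volume_eq_sum_firstOf {U : Finset α} (hU : U.Nonempty) {B : Set (α → unitInterval)}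
    (hB : B ⊆ distinctIndices α) : volume B = ∑ b ∈ U, volume (B ∩ firstOf U b) := by
  -- `B` need not be measurable: additivity for the restricted measure asks only for measurability
  -- of the events `firstOf U b`.
  have h1 := measure_biUnion_finset (μ := volume.restrict B) (s := U) (f := firstOf U)
    (fun b hb c hc hne => disjoint_firstOf hb hc hne) (fun b _ => measurableSet_firstOf U b)
  have hm : MeasurableSet (⋃ b ∈ U, firstOf U b) :=
    U.measurableSet_biUnion fun b _ => measurableSet_firstOf U b
  rw [Measure.restrict_apply hm, inter_eq_right.2] at h1
  · rw [h1]
    refine Finset.sum_congr rfl fun b _ => ?_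
    rw [Measure.restrict_apply (measurableSet_firstOf U b), inter_comm]
  · intro u hu
    obtain ⟨b, hb, h⟩ := exists_mem_firstOf hU (hB hu)
    exact mem_iUnion₂.2 ⟨b, hb, h⟩

variable [DecidableEq α]

/-- The event `A` is invariant under exchanging the indices of two elements of `U`. -/
def SwapInvariant (A : Set (α → unitInterval)) (U : Finset α) : Prop :=
  ∀ x ∈ U, ∀ y ∈ U, ∀ u ∈ A, u ∘ Equiv.swap x y ∈ A

theorem SwapInvariant.mono {A : Set (α → unitInterval)} {U W : Finset α}
    (hA : SwapInvariant A U) (h : W ⊆ U) : SwapInvariant A W :=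
  fun x hx y hy => hA x (h hx) y (h hy)

theorem swapInvariant_distinctIndices (U : Finset α) : SwapInvariant (distinctIndices α) U :=
  fun x _ y _ _ hu => Function.Injective.comp hu (Equiv.swap x y).injective

theorem swap_mem {U : Finset α} {x y z : α} (hx : x ∈ U) (hy : y ∈ U) (hz : z ∈ U) :
    Equiv.swap x y z ∈ U := by
  rw [Equiv.swap_apply_def]
  split_ifs <;> assumption

theorem firstOf_comp_swap {U : Finset α} {x y b : α} (hx : x ∈ U) (hy : y ∈ U)
    {u : α → unitInterval} (hu : u ∈ firstOf U b) :
    u ∘ Equiv.swap x y ∈ firstOf U (Equiv.swap x y b) := by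
  intro z hz hne
  simp only [Function.comp_apply, Equiv.swap_apply_self]
  refine hu _ (swap_mem hx hy hz) fun e => hne ?_
  rw [← e, Equiv.swap_apply_self]

/-- Swapping two elements other than `b` leaves the minimizer `b` in place, so learning it reveals
nothing about the order of the rest. -/
theorem SwapInvariant.inter_firstOf {A : Set (α → unitInterval)} {U : Finset α}
    (hA : SwapInvariant A U) (b : α) : SwapInvariant (A ∩ firstOf U b) (U.erase b) := by
  intro x hx y hy u hu
  obtain ⟨hxb, hx⟩ := Finset.mem_erase.1 hx
  obtain ⟨hyb, hy⟩ := Finset.mem_erase.1 hy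
  refine ⟨hA x hx y hy u hu.1, ?_⟩
  have := firstOf_comp_swap hx hy hu.2
  rwa [Equiv.swap_apply_of_ne_of_ne hxb.symm hyb.symm] at this

theorem volume_preimage_comp_equiv (σ : Equiv.Perm α) (B : Set (α → unitInterval)) :
    volume ((fun u => u ∘ σ) ⁻¹' B) = volume B := by
  have h := (volume_measurePreserving_piCongrLeft (fun _ : α => unitInterval) σ.symm)
  have he : ∀ u : α → unitInterval,
      MeasurableEquiv.piCongrLeft (fun _ : α => unitInterval) σ.symm u = u ∘ σ := by
    intro u
    funext a
    obtain ⟨a, rfl⟩ := σ.symm.surjective a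
    rw [MeasurableEquiv.coe_piCongrLeft, Equiv.piCongrLeft_apply_apply]
    simp
  rw [← h.measure_preimage_equiv B]
  congr 1
  ext u
  simp [he]

theorem SwapInvariant.volume_inter_firstOf_eq {A : Set (α → unitInterval)} {U : Finset α}
    (hA : SwapInvariant A U) {b c : α} (hb : b ∈ U) (hc : c ∈ U) :
    volume (A ∩ firstOf U b) = volume (A ∩ firstOf U c) := by
  rw [← volume_preimage_comp_equiv (Equiv.swap b c) (A ∩ firstOf U c)]
  congr 1
  ext u
  constructor
  · intro hu
    refine ⟨hA b hb c hc u hu.1, ?_⟩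
    have := firstOf_comp_swap hb hc hu.2
    rwa [Equiv.swap_apply_left] at this
  · intro hu
    -- The swap is an involution, so the reverse inclusion follows from invariance as well.
    have huu : u = (u ∘ Equiv.swap b c) ∘ Equiv.swap b c := by
      funext z; simp
    rw [huu]
    refine ⟨hA b hb c hc _ hu.1, ?_⟩
    have := firstOf_comp_swap hb hc hu.2
    rwa [Equiv.swap_apply_right] at this

/-- The events `firstOf U c` split `A` into pieces that swaps carry to one another, hence of equal
volume. -/
theorem SwapInvariant.card_mul_volume_inter_firstOf {A : Set (α → unitInterval)} {U : Finset α}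
    (hA : SwapInvariant A U) (hAd : A ⊆ distinctIndices α) {b : α} (hb : b ∈ U) :
    (U.card : ℝ≥0∞) * volume (A ∩ firstOf U b) = volume A := by
  rw [volume_eq_sum_firstOf ⟨b, hb⟩ hAd,
    Finset.sum_congr rfl fun c hc => hA.volume_inter_firstOf_eq hc hb, Finset.sum_const,
    nsmul_eq_mul]

end Exchangeable

/-! ### Uniformity of the constructed matching -/

section Uniformity

open scoped ENNReal

variable {V : Type*} [Fintype V] [DecidableEq V] {d : V → ℕ}

/-- The probability of each perfect matching of `2 * k` stubs. -/
noncomputable def matchingWeight (k : ℕ) : ℝ≥0∞ := ∏ j ∈ Finset.range k, ((2 * j + 1 : ℕ) : ℝ≥0∞)⁻¹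

theorem matchingWeight_succ (k : ℕ) :
    matchingWeight (k + 1) = matchingWeight k * ((2 * k + 1 : ℕ) : ℝ≥0∞)⁻¹ :=
  Finset.prod_range_succ _ _

/-- Were the `M`-partner of `a` already matched, its edge would lie in `M` and hence be the edge to
`a`, which is still unmatched. -/
theorem Pending.exists_partner {a : Stub d} {s : State d} (hs : Pending a s)
    {M : Finset (Sym2 (Stub d))} (hM : IsPerfectMatching M) (hsub : s.edgeSet ⊆ M) :
    ∃ b ∈ s.unmatched.erase a, ∀ c, s(a, c) ∈ M ↔ c = b := by
  obtain ⟨e, ⟨heM, hae⟩, huniq⟩ := hM.2 a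
  obtain ⟨b, rfl⟩ := Sym2.mem_iff_exists.1 hae
  refine ⟨b, Finset.mem_erase.2 ⟨?_, ?_⟩, fun c => ⟨fun h => ?_, ?_⟩⟩
  · rintro rfl
    exact hM.1 _ heM (by simp)
  · rw [State.mem_unmatched_iff]
    intro e' he' hb
    have := (hM.2 b).unique ⟨heM, Sym2.mem_mk_right a b⟩ ⟨hsub he', hb⟩
    exact State.mem_unmatched_iff.1 hs.mem_unmatched e' he' (this ▸ hae)
  · exact Sym2.congr_right.1 (huniq _ ⟨h, Sym2.mem_mk_left a c⟩)
  · rintro rfl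
    exact heM

/-- Conditionally on any exchangeable event, every perfect matching that extends the matching built
so far is equally likely to be constructed by the next `k` iterations. -/
def UniformFrom (D : Discipline d) (M : Finset (Sym2 (Stub d))) (k : ℕ) : Prop :=
  ∀ (s : State d) (A : Set (Stub d → unitInterval)), Consistent s → s.unmatched.card = 2 * k →
    s.edgeSet ⊆ M → A ⊆ distinctIndices _ → SwapInvariant A s.unmatched →
    volume (A ∩ {u | ((step D u)^[k] s).edgeSet = M}) = matchingWeight k * volume A

/-- Edges are never removed, so reaching `M` forces the scan to find the `M`-partner `b` of `a`.
That is one of `2k+1` equally likely candidates. On this event the next state is the fixed state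
`link a b s`, and exchangeability of the remaining stubs survives. -/
theorem UniformFrom.volume_follow {D : Discipline d} {M : Finset (Sym2 (Stub d))} {k : ℕ}
    (ih : UniformFrom D M k) (hM : IsPerfectMatching M) {a : Stub d} {s : State d}
    {A : Set (Stub d → unitInterval)} (hs : Pending a s) (hc : s.unmatched.card = 2 * (k + 1))
    (hsub : s.edgeSet ⊆ M) (hAd : A ⊆ distinctIndices _)
    (hA : SwapInvariant A (s.unmatched.erase a)) :
    volume (A ∩ {u | ((step D u)^[k] (follow u a s)).edgeSet = M}) =
      matchingWeight (k + 1) * volume A := by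
  obtain ⟨b, hb, hpartner⟩ := hs.exists_partner hM hsub
  have hcard : (s.unmatched.erase a).card = 2 * k + 1 := by
    rw [Finset.card_erase_of_mem hs.mem_unmatched]; omega
  have hset : A ∩ {u | ((step D u)^[k] (follow u a s)).edgeSet = M} =
      (A ∩ firstOf (s.unmatched.erase a) b) ∩
        {u | ((step D u)^[k] (link a b s)).edgeSet = M} := by
    ext u
    constructor
    · rintro ⟨huA, hu⟩
      obtain ⟨c, hcU, hcu⟩ := exists_mem_firstOf ⟨b, hb⟩ (hAd huA)
      simp only [mem_ofPred_eq, follow_of_scan (scan_eq_some hcU hcu)] at hu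
      have hac : s(a, c) ∈ M := by
        rw [← hu]
        exact edgeSet_subset_iterate D u k _ (by rw [edgeSet_link]; exact Finset.mem_insert_self _ _)
      obtain rfl := (hpartner c).1 hac
      exact ⟨⟨huA, hcu⟩, hu⟩
    · rintro ⟨⟨huA, hbu⟩, hu⟩
      refine ⟨huA, ?_⟩
      simpa only [mem_ofPred_eq, follow_of_scan (scan_eq_some hb hbu)] using hu
  rw [hset, ih (link a b s) _ (hs.consistent_link hb), matchingWeight_succ, mul_assoc]
  · congr 1
    have h := hA.card_mul_volume_inter_firstOf hAd hb
    rw [hcard] at h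
    rw [← h, ← mul_assoc, ENNReal.inv_mul_cancel (by simp) (ENNReal.natCast_ne_top _), one_mul]
  · rw [unmatched_link, Finset.card_erase_of_mem hb, hcard]; omega
  · rw [edgeSet_link]
    exact Finset.insert_subset ((hpartner b).2 rfl) hsub
  · exact inter_subset_left.trans hAd
  · rw [unmatched_link]
    exact hA.inter_firstOf b

theorem uniformFrom (D : Discipline d) {M : Finset (Sym2 (Stub d))} (hM : IsPerfectMatching M)
    (k : ℕ) : UniformFrom D M k := by
  induction k with
  | zero =>
    intro s A hs hc hsub hAd hA
    have hU : s.unmatched = ∅ := Finset.card_eq_zero.1 (by simpa using hc)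
    have heq : s.edgeSet = M := by
      refine hsub.antisymm fun e he => ?_
      induction e using Sym2.ind with
      | _ x y =>
        have hx : x ∉ s.unmatched := by simp [hU]
        rw [State.mem_unmatched_iff] at hx
        push Not at hx
        obtain ⟨e', he', hxe'⟩ := hx
        rwa [(hM.2 x).unique ⟨he, Sym2.mem_mk_left x y⟩ ⟨hsub he', hxe'⟩]
    simp [heq, matchingWeight]
  | succ k ih =>
    intro s A hs hc hsub hAd hA
    simp only [Function.iterate_succ_apply]
    by_cases hq : s.queue = []
    · have hne : s.unmatched.Nonempty := Finset.card_pos.1 (by omega)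
      -- With an empty queue, `a` is itself random. Splitting over its value costs only the swaps
      -- that move `a`, and the factor obtained is the same for every `a`.
      rw [volume_eq_sum_firstOf hne (inter_subset_left.trans hAd), volume_eq_sum_firstOf hne hAd,
        Finset.mul_sum]
      refine Finset.sum_congr rfl fun a ha => ?_
      rw [← ih.volume_follow hM (s := discover a s) (hs.pending_discover hq ha) hc hsub
        (inter_subset_left.trans hAd) (hA.inter_firstOf a)]
      congr 1
      ext u
      constructor
      · rintro ⟨⟨huA, hu⟩, hau⟩
        refine ⟨⟨huA, hau⟩, ?_⟩
        simpa only [mem_ofPred_eq, step_of_queue_nil hq (scan_eq_some ha hau)] using hu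
      · rintro ⟨⟨huA, hau⟩, hu⟩
        refine ⟨⟨huA, ?_⟩, hau⟩
        simpa only [mem_ofPred_eq, step_of_queue_nil hq (scan_eq_some ha hau)] using hu
    · simp only [step_of_queue_ne_nil hq]
      exact ih.volume_follow hM (hs.pending_dequeue (D.pick_mem s hq)) hc hsub hAd
        (hA.mono (Finset.erase_subset _ _))

theorem volume_inter_matching_eq (heven : Even (∑ v, d v)) (D : Discipline d)
    {M : Finset (Sym2 (Stub d))} (hM : IsPerfectMatching M) :
    volume (distinctIndices (Stub d) ∩ {u | matching D u = M}) =
      matchingWeight (Fintype.card (Stub d) / 2) := by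
  have h := uniformFrom D hM (Fintype.card (Stub d) / 2) (State.init d) (distinctIndices _)
    consistent_init (card_unmatched_init heven) (by simp [State.edgeSet, State.init]) subset_rfl
    (swapInvariant_distinctIndices _)
  rw [volume_distinctIndices, mul_one] at h
  exact h

theorem volume_matching_eq (heven : Even (∑ v, d v)) (D : Discipline d)
    {M : Finset (Sym2 (Stub d))} (hM : IsPerfectMatching M) :
    volume {u | matching D u = M} = matchingWeight (Fintype.card (Stub d) / 2) := by
  rw [← volume_inter_matching_eq heven D hM, inter_comm,
    measure_inter_conull volume_compl_distinctIndices]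

/-! ### Measurability and normalization -/

theorem step_congr (D : Discipline d) {u u' : Stub d → unitInterval} (h : scan u = scan u') :
    step D u = step D u' := by
  funext s
  simp only [step, follow, h]

theorem matching_congr (D : Discipline d) {u u' : Stub d → unitInterval}
    (h : scan u = scan u') : matching D u = matching D u' := by
  simp only [matching, run, step_congr D h]

theorem scan_congr {u u' : Stub d → unitInterval} (hu : u ∈ distinctIndices _)
    (h : ∀ x y, u x < u y ↔ u' x < u' y) : scan u = scan u' := by
  funext U
  rcases U.eq_empty_or_nonempty with rfl | hU
  · simp [scan]
  · obtain ⟨b, hb, hbu⟩ := exists_mem_firstOf hU hu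
    rw [scan_eq_some hb hbu, scan_eq_some hb fun x hx hne => (h b x).1 (hbu x hx hne)]

/-- For distinct indices the traversal depends only on their relative order, so the event is a
finite union of order events. -/
theorem measurableSet_inter_matching (D : Discipline d) (M : Finset (Sym2 (Stub d))) :
    MeasurableSet (distinctIndices (Stub d) ∩ {u | matching D u = M}) := by
  let order : (Stub d → unitInterval) → Set (Stub d × Stub d) := fun u => {p | u p.1 < u p.2}
  have hset : distinctIndices (Stub d) ∩ {u | matching D u = M} =
      distinctIndices (Stub d) ∩
        ⋃ r ∈ order '' (distinctIndices (Stub d) ∩ {u | matching D u = M}), {u | order u = r} := by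
    ext u
    constructor
    · intro hu
      exact ⟨hu.1, mem_iUnion₂.2 ⟨_, mem_image_of_mem order hu, rfl⟩⟩
    · rintro ⟨hu, h⟩
      obtain ⟨r, ⟨u', hu', rfl⟩, hr⟩ := mem_iUnion₂.1 h
      refine ⟨hu, ?_⟩
      rw [mem_ofPred_eq, ← hu'.2]
      exact matching_congr D (scan_congr hu fun x y => Set.ext_iff.1 hr (x, y))
  rw [hset]
  refine measurableSet_distinctIndices.inter
    (MeasurableSet.biUnion (Set.toFinite _).countable fun r _ => ?_)
  simp only [Set.ext_iff, ofPred_forall]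
  refine MeasurableSet.iInter fun p => ?_
  exact (measurableSet_lt (measurable_pi_apply p.1) (measurable_pi_apply p.2)).iff
    (MeasurableSet.const _)

/-- Perfect matchings need not be counted: the traversal always yields one, so their equal
probabilities add up to one. -/
theorem card_mul_matchingWeight (heven : Even (∑ v, d v)) (D : Discipline d) :
    (Nat.card {M : Finset (Sym2 (Stub d)) // IsPerfectMatching M} : ℝ≥0∞) *
      matchingWeight (Fintype.card (Stub d) / 2) = 1 := by
  classical
  rw [Nat.card_eq_fintype_card, ← volume_distinctIndices (α := Stub d)]
  have hcover : distinctIndices (Stub d) =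
      ⋃ M : {M : Finset (Sym2 (Stub d)) // IsPerfectMatching M},
        distinctIndices (Stub d) ∩ {u | matching D u = M.1} := by
    ext u
    simp only [mem_iUnion, mem_inter_iff, mem_ofPred_eq, exists_and_left]
    exact ⟨fun hu => ⟨hu, ⟨_, isPerfectMatching_matching heven D u⟩, rfl⟩, fun h => h.1⟩
  conv_rhs => rw [hcover]
  rw [measure_iUnion, tsum_fintype,
    Finset.sum_congr rfl fun M _ => volume_inter_matching_eq heven D M.2, Finset.sum_const,
    nsmul_eq_mul, Finset.card_univ]
  · intro M M' hne
    refine Set.disjoint_left.2 fun u h h' => hne (Subtype.ext ?_)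
    rw [← h.2, ← h'.2]
  · exact fun M => measurableSet_inter_matching D M.1

/-- The constructed matching is uniformly distributed. -/
theorem volume_real_matching_eq (heven : Even (∑ v, d v)) (D : Discipline d)
    {M : Finset (Sym2 (Stub d))} (hM : IsPerfectMatching M) :
    volume.real {u : Stub d → unitInterval | matching D u = M} =
      1 / (Nat.card {M' : Finset (Sym2 (Stub d)) // IsPerfectMatching M'} : ℝ) := by
  have h := congrArg ENNReal.toReal (card_mul_matchingWeight heven D)
  rw [ENNReal.toReal_mul, ENNReal.toReal_natCast, ENNReal.toReal_one] at h
  rw [measureReal_def, volume_matching_eq heven D hM, eq_div_iff (left_ne_zero_of_mul_eq_one h),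
    mul_comm, h]

end Uniformity

/-! ### Expected samples and the cover time -/

section Expectation

variable {V : Type*} [Fintype V] [DecidableEq V] {d : V → ℕ}

/-- The event is a box: each stub of `v` contributes a factor `1 - t`, every other stub a factor
`1`. -/
theorem volume_real_forall_lt {t : ℝ} (ht : t ∈ Icc (0 : ℝ) 1) (v : V) :
    volume.real {u : Stub d → unitInterval | ∀ i, t < u ⟨v, i⟩} = (1 - t) ^ d v := by
  let T : unitInterval := ⟨t, ht⟩
  have hT : ∀ x : unitInterval, T < x ↔ t < x := fun _ => Iff.rfl
  have hset : {u : Stub d → unitInterval | ∀ i, t < u ⟨v, i⟩} =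
      Set.pi univ fun x : Stub d => if x.1 = v then Ioi T else univ := by
    ext u
    simp only [mem_ofPred_eq, mem_pi, mem_univ, forall_const]
    constructor
    · rintro h ⟨w, i⟩
      by_cases hw : w = v
      · subst hw
        simpa [hT] using h i
      · simp [hw]
    · intro h i
      simpa [hT] using h ⟨v, i⟩
  have hfac : ∀ w, (∏ i : Fin (d w), volume (if w = v then Ioi T else univ)) =
      if w = v then ENNReal.ofReal (1 - t) ^ d v else 1 := by
    intro w
    by_cases hw : w = v
    · subst hw
      simp [T]
    · simp [hw]
  rw [hset, measureReal_def, volume_pi_pi, Fintype.prod_sigma]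
  simp only [hfac]
  rw [Finset.prod_ite_eq' Finset.univ v, if_pos (Finset.mem_univ v), ENNReal.toReal_pow,
    ENNReal.toReal_ofReal (by linarith [ht.2])]

theorem measurableSet_exists_le (t : ℝ) (v : V) :
    MeasurableSet {u : Stub d → unitInterval | ∃ i, (u ⟨v, i⟩ : ℝ) ≤ t} := by
  simp only [ofPred_exists]
  exact MeasurableSet.iUnion fun i =>
    measurableSet_le (measurable_subtype_coe.comp (measurable_pi_apply _)) measurable_const

theorem volume_real_exists_le {t : ℝ} (ht : t ∈ Icc (0 : ℝ) 1) (v : V) :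
    volume.real {u : Stub d → unitInterval | ∃ i, (u ⟨v, i⟩ : ℝ) ≤ t} = 1 - (1 - t) ^ d v := by
  rw [← volume_real_forall_lt ht v]
  have hcompl : {u : Stub d → unitInterval | ∀ i, t < u ⟨v, i⟩} =
      {u : Stub d → unitInterval | ∃ i, (u ⟨v, i⟩ : ℝ) ≤ t}ᶜ := by
    ext u; simp
  rw [hcompl, probReal_compl_eq_one_sub (measurableSet_exists_le t v)]
  ring

/-- The expectation of an additive functional of the set of nodes sampled by time `t`. -/
theorem integral_sum_sampledBy (heven : Even (∑ v, d v)) (D : Discipline d) {t : ℝ}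
    (ht : t ∈ Icc (0 : ℝ) 1) (g : V → ℝ) :
    ∫ u : Stub d → unitInterval, (∑ v ∈ sampledBy D u t, g v) / Fintype.card V =
      (∑ v, g v * (1 - (1 - t) ^ d v)) / Fintype.card V := by
  rw [integral_div]
  congr 1
  have hsum : ∀ u : Stub d → unitInterval, ∑ v ∈ sampledBy D u t, g v =
      ∑ v, {u : Stub d → unitInterval | ∃ i, (u ⟨v, i⟩ : ℝ) ≤ t}.indicator (fun _ => g v) u := by
    intro u
    rw [← Finset.sum_subset (Finset.subset_univ (sampledBy D u t))]
    · refine Finset.sum_congr rfl fun v hv => ?_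
      rw [indicator_of_mem]
      exact (mem_sampledBy_iff heven D u t v).1 hv
    · intro v _ hv
      rw [indicator_of_notMem]
      exact fun h => hv ((mem_sampledBy_iff heven D u t v).2 h)
  simp only [hsum]
  rw [integral_finsetSum _ fun v _ =>
    (integrable_const (g v)).indicator (measurableSet_exists_le t v)]
  refine Finset.sum_congr rfl fun v _ => ?_
  rw [integral_indicator_const _ (measurableSet_exists_le t v), volume_real_exists_le ht,
    smul_eq_mul, mul_comm]

/-- Averages over the nodes of a function of the degree in terms of the degree distribution. -/
theorem sum_degreeDist_mul (d : V → ℕ) (h : ℕ → ℝ) :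
    ∑ k ∈ Finset.range (maxDegree d + 1), degreeDist d k * h k =
      (∑ v, h (d v)) / Fintype.card V := by
  have hmem : ∀ v ∈ Finset.univ, d v ∈ Finset.range (maxDegree d + 1) := fun v _ =>
    Finset.mem_range.2 (Nat.lt_succ_of_le (Finset.le_sup (f := d) (Finset.mem_univ v)))
  rw [← Finset.sum_fiberwise_of_maps_to hmem, Finset.sum_div]
  refine Finset.sum_congr rfl fun k _ => ?_
  rw [Finset.sum_congr rfl fun v hv => by rw [(Finset.mem_filter.1 hv).2], Finset.sum_const,
    nsmul_eq_mul, degreeDist]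
  ring

theorem sum_degreeDist [Nonempty V] (d : V → ℕ) :
    ∑ k ∈ Finset.range (maxDegree d + 1), degreeDist d k = 1 := by
  have h := sum_degreeDist_mul d fun _ => 1
  simpa using h

theorem expectedSampled_eq (heven : Even (∑ v, d v)) (D : Discipline d) (k : ℕ) {t : ℝ}
    (ht : t ∈ Icc (0 : ℝ) 1) :
    expectedSampled D k t = degreeDist d k * (1 - (1 - t) ^ k) := by
  have h := integral_sum_sampledBy heven D ht fun v => if d v = k then 1 else 0
  simp only [Finset.sum_boole] at h
  rw [expectedSampled, h, degreeDist, div_mul_eq_mul_div]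
  congr 1
  simp only [ite_mul, one_mul, zero_mul]
  rw [← Finset.sum_filter, Finset.sum_congr rfl fun v hv => by rw [(Finset.mem_filter.1 hv).2],
    Finset.sum_const, nsmul_eq_mul]

theorem expectedCovered_eq_sum (heven : Even (∑ v, d v)) (D : Discipline d) {t : ℝ}
    (ht : t ∈ Icc (0 : ℝ) 1) :
    expectedCovered D t =
      ∑ k ∈ Finset.range (maxDegree d + 1), degreeDist d k * (1 - (1 - t) ^ k) := by
  have h := integral_sum_sampledBy heven D ht fun _ => 1
  simp only [Finset.sum_const, nsmul_eq_mul, mul_one, one_mul] at h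
  rw [expectedCovered, h, sum_degreeDist_mul d fun k => 1 - (1 - t) ^ k]

theorem expectedSampledDegree_eq_sum (heven : Even (∑ v, d v)) (D : Discipline d) {t : ℝ}
    (ht : t ∈ Icc (0 : ℝ) 1) :
    expectedSampledDegree D t =
      ∑ k ∈ Finset.range (maxDegree d + 1), (k : ℝ) * expectedSampled D k t := by
  rw [expectedSampledDegree, integral_sum_sampledBy heven D ht fun v => (d v : ℝ),
    ← sum_degreeDist_mul d fun k => (k : ℝ) * (1 - (1 - t) ^ k)]
  refine Finset.sum_congr rfl fun k _ => ?_
  rw [expectedSampled_eq heven D k ht]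
  ring

theorem expectedCovered_eq [Nonempty V] (heven : Even (∑ v, d v)) (D : Discipline d) {t : ℝ}
    (ht : t ∈ Icc (0 : ℝ) 1) :
    expectedCovered D t =
      1 - ∑ k ∈ Finset.range (maxDegree d + 1), degreeDist d k * (1 - t) ^ k := by
  rw [expectedCovered_eq_sum heven D ht]
  simp only [mul_sub, mul_one, Finset.sum_sub_distrib, sum_degreeDist]

theorem degreeDist_nonneg (d : V → ℕ) (k : ℕ) : 0 ≤ degreeDist d k := by
  unfold degreeDist; positivity

theorem degreeDist_pos (d : V → ℕ) (v : V) : 0 < degreeDist d (d v) := by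
  have h1 : 0 < (Finset.univ.filter fun w => d w = d v).card :=
    Finset.card_pos.2 ⟨v, by simp⟩
  have h2 : 0 < Fintype.card V := Fintype.card_pos_iff.2 ⟨v⟩
  unfold degreeDist; positivity

theorem continuousOn_expectedCovered [Nonempty V] (heven : Even (∑ v, d v)) (D : Discipline d) :
    ContinuousOn (expectedCovered D) (Icc 0 1) := by
  refine ContinuousOn.congr ?_ fun t ht => expectedCovered_eq heven D ht
  fun_prop

/-- Every degree contributes a nondecreasing term, and the degree of a node that owns a stub
contributes a strictly increasing one. -/
theorem strictMonoOn_expectedCovered (heven : Even (∑ v, d v)) (hpos : ∃ v, 0 < d v)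
    (D : Discipline d) : StrictMonoOn (expectedCovered D) (Icc 0 1) := by
  intro s hs t ht hst
  rw [expectedCovered_eq_sum heven D hs, expectedCovered_eq_sum heven D ht]
  obtain ⟨v, hv⟩ := hpos
  refine Finset.sum_lt_sum (fun k _ => ?_) ⟨d v, Finset.mem_range.2
    (Nat.lt_succ_of_le (Finset.le_sup (f := d) (Finset.mem_univ v))), ?_⟩
  · have := pow_le_pow_left₀ (by linarith [ht.2] : 0 ≤ 1 - t) (by linarith : 1 - t ≤ 1 - s) k
    exact mul_le_mul_of_nonneg_left (by linarith) (degreeDist_nonneg d k)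
  · have := pow_lt_pow_left₀ (by linarith : 1 - t < 1 - s) (by linarith [ht.2]) hv.ne'
    exact mul_lt_mul_of_pos_left (by linarith) (degreeDist_pos d v)

theorem expectedCovered_zero (heven : Even (∑ v, d v)) (D : Discipline d) :
    expectedCovered D 0 = 0 := by
  rw [expectedCovered_eq_sum heven D (by simp)]
  simp

theorem expectedCovered_one [Nonempty V] (heven : Even (∑ v, d v)) (D : Discipline d) :
    expectedCovered D 1 = 1 - degreeDist d 0 := by
  -- At `t = 1` only the term `k = 0` survives, since `0 ^ 0 = 1`.
  rw [expectedCovered_eq heven D (by simp), Finset.sum_range_succ']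
  simp

theorem bijOn_expectedCovered (heven : Even (∑ v, d v)) (hpos : ∃ v, 0 < d v)
    (D : Discipline d) : BijOn (expectedCovered D) (Icc 0 1) (Icc 0 (1 - degreeDist d 0)) := by
  have : Nonempty V := ⟨hpos.choose⟩
  have hmono := strictMonoOn_expectedCovered heven hpos D
  have h0 := expectedCovered_zero heven D
  have h1 := expectedCovered_one heven D
  refine ⟨fun t ht => ?_, hmono.injOn, ?_⟩
  · rw [← h1, ← h0]
    exact ⟨hmono.monotoneOn (by simp) ht ht.1, hmono.monotoneOn ht (by simp) ht.2⟩
  · have h := intermediate_value_Icc zero_le_one (continuousOn_expectedCovered heven D)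
    rwa [h0, h1] at h

theorem coverTime_mem (heven : Even (∑ v, d v)) (hpos : ∃ v, 0 < d v) (D : Discipline d) {f : ℝ}
    (hf : f ∈ Ioc (0 : ℝ) (1 - degreeDist d 0)) : coverTime D f ∈ Ioc (0 : ℝ) 1 := by
  have hbij := bijOn_expectedCovered heven hpos D
  have hmem : f ∈ Icc (0 : ℝ) (1 - degreeDist d 0) := ⟨hf.1.le, hf.2⟩
  have hIcc : coverTime D f ∈ Icc (0 : ℝ) 1 := hbij.surjOn.mapsTo_invFunOn hmem
  have hval : expectedCovered D (coverTime D f) = f := hbij.invOn_invFunOn.2 hmem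
  refine ⟨lt_of_le_of_ne hIcc.1 fun h => hf.1.ne ?_, hIcc.2⟩
  rw [← hval, ← h, expectedCovered_zero heven D]

end Expectation

end StubTraversal

open StubTraversal in
theorem mainTheorem1 {V : Type*} [Fintype V] [DecidableEq V] (d : V → ℕ)
    (heven : Even (∑ v, d v)) (hpos : ∃ v, 0 < d v) (D : Discipline d) :
    -- the graph constructed on the fly is the configuration model
    (∀ M : Finset (Sym2 (Stub d)), IsPerfectMatching M →
      volume.real {u : Stub d → unitInterval | matching D u = M} =
        1 / (Nat.card {M' : Finset (Sym2 (Stub d)) // IsPerfectMatching M'} : ℝ)) ∧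
    -- expected fraction of sampled nodes of each degree
    (∀ k : ℕ, ∀ t ∈ Icc (0 : ℝ) 1,
      expectedSampled D k t = degreeDist d k * (1 - (1 - t) ^ k)) ∧
    -- expected covered fraction and its inverse
    (∀ t ∈ Icc (0 : ℝ) 1,
      expectedCovered D t =
        1 - ∑ k ∈ Finset.range (maxDegree d + 1), degreeDist d k * (1 - t) ^ k) ∧
    ContinuousOn (expectedCovered D) (Icc 0 1) ∧
    StrictMonoOn (expectedCovered D) (Icc 0 1) ∧
    BijOn (expectedCovered D) (Icc 0 1) (Icc 0 (1 - degreeDist d 0)) ∧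
    InvOn (coverTime D) (expectedCovered D) (Icc 0 1) (Icc 0 (1 - degreeDist d 0)) ∧
    -- expected observed degree distribution and its mean
    (∀ f ∈ Ioc (0 : ℝ) (1 - degreeDist d 0),
      coverTime D f ∈ Ioc (0 : ℝ) 1 ∧
      0 < ∑ l ∈ Finset.range (maxDegree d + 1), degreeDist d l * (1 - (1 - coverTime D f) ^ l) ∧
      (∀ k : ℕ, observedDist D k f =
        degreeDist d k * (1 - (1 - coverTime D f) ^ k) /
          ∑ l ∈ Finset.range (maxDegree d + 1),
            degreeDist d l * (1 - (1 - coverTime D f) ^ l)) ∧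
      ∑ k ∈ Finset.range (maxDegree d + 1), observedDist D k f = 1 ∧
      observedMean D f = ∑ k ∈ Finset.range (maxDegree d + 1), (k : ℝ) * observedDist D k f) := by
  have : Nonempty V := ⟨hpos.choose⟩
  have hbij := bijOn_expectedCovered heven hpos D
  refine ⟨fun M hM => volume_real_matching_eq heven D hM,
    fun k t ht => expectedSampled_eq heven D k ht, fun t ht => expectedCovered_eq heven D ht,
    continuousOn_expectedCovered heven D, strictMonoOn_expectedCovered heven hpos D, hbij,
    hbij.invOn_invFunOn, fun f hf => ?_⟩
  have ht := coverTime_mem heven hpos D hf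
  have htI : coverTime D f ∈ Icc (0 : ℝ) 1 := ⟨ht.1.le, ht.2⟩
  have hval : expectedCovered D (coverTime D f) = f :=
    hbij.invOn_invFunOn.2 ⟨hf.1.le, hf.2⟩
  have hsum := expectedCovered_eq_sum heven D htI
  refine ⟨ht, ?_, fun k => ?_, ?_, ?_⟩
  -- The denominator is the expected covered fraction at the cover time, that is, `f` itself.
  · rw [← hsum, hval]
    exact hf.1
  · rw [observedDist, expectedSampled_eq heven D k htI, hsum]
  · simp only [observedDist]
    rw [← Finset.sum_div, Finset.sum_congr rfl fun k _ => expectedSampled_eq heven D k htI, ← hsum,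
      hval, div_self hf.1.ne']
  · simp only [observedMean, observedDist]
    rw [expectedSampledDegree_eq_sum heven D htI, Finset.sum_div]
    exact Finset.sum_congr rfl fun k _ => mul_div_assoc _ _ _
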